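/- Let $\gamma\in(0,1)$, $\beta>1$, $\mu>0$, $\epsilon>0$, let $|D|$ be the Fourier multiplier $\widehat{|D|f}(y)=|y|\hat f(y)$ (for the Fourier transform with kernel $e^{-ixy}$), and put $$\mathcal D=1+\frac{\beta}{\gamma}\sqrt{\mu}\,|D|,\qquad \mathcal B=\frac1\gamma\Big(1+\frac{\beta-1}{\gamma}\sqrt{\mu}\,|D|\Big).$$ Let $c\in\mathbb R$ satisfy $c^2<\dfrac{(\beta-1)(1-\gamma)}{\beta\gamma}$, and let $(\xi,\nu)\in H^1(\mathbb R)\times H^1(\mathbb R)$ be a pair of real-valued functions (identified with their continuous representatives) that solves the solitary wave equations of the Benjamin–Ono system with speed $c$, $$-c\,\mathcal D\xi+\mathcal B\nu=\frac{\epsilon}{\gamma}\,\xi\nu,\qquad \xi=\frac1{1-\gamma}\Big(c\,\nu+\frac{\epsilon}{2\gamma}\,\nu^2\Big).$$ Then there exists a constant $N\in\mathbb R$ such that for all $x\in\mathbb R$, $$x^2|\xi(x)|\le N\qquad\text{and}\qquad x^2|\nu(x)|\le N .$$ In particular, this holds for the even solitary waves $(\xi_c,\nu_c)\in H^1(\mathbb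 R)\times H^1(\mathbb R)$ of small speed $c$ on the smooth curves of solutions of this system that pass at $c=0$ through $(\xi_0,\nu_0)$ or $(\xi_0,-\nu_0)$, where $\nu_0$ is the even positive solution of $\frac{\beta-1}{\gamma^2}\sqrt\mu\,|D|\nu_0+\frac1\gamma\nu_0-\frac{\epsilon^2}{2\gamma^2(1-\gamma)}\nu_0^3=0$ and $\xi_0=\frac{\epsilon}{2\gamma(1-\gamma)}\nu_0^2$. -/

import Mathlib

open MeasureTheory FourierTransform
open scoped SchwartzMap ENNReal

namespace BenjaminOno

noncomputable section

/-- The complex Hilbert space `L²(ℝ)` (with Lebesgue measure). -/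
abbrev L2 : Type := Lp ℂ 2 (volume : Measure ℝ)

/-- The class in `L²(ℝ)` of a real function on the line (`0` if the function is not square
integrable; it is only used for functions that are). -/
def toL2 (f : ℝ → ℝ) : L2 :=
  open scoped Classical in
  if h : MemLp (fun x => (f x : ℂ)) 2 volume then h.toLp else 0

/-- `f` belongs to the Sobolev space `H¹(ℝ)`. -/
structure MemH1 (f : ℝ → ℝ) : Prop where
  memLp : MemLp (fun x => (f x : ℂ)) 2 volume
  memSobolev : TemperedDistribution.MemSobolev 1 2 (toL2 f : 𝓢'(ℝ, ℂ))

/-- The function `y ↦ |2πy| 𝓕f(y)`. Here `𝓕` is the `L²` Fourier transform of Mathlib, with kernel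
`exp (-2πi x y)`, so that the angular frequency `2πy` stands where the usual symbol `|y|` of `|D|`
has the frequency for the kernel `exp (-i x y)`. -/
def absDSymbol (f : L2) : ℝ → ℂ := fun y => ((|2 * Real.pi * y| : ℝ) : ℂ) * (𝓕 f : L2) y

/-- The operator `|D|`, that is the Fourier multiplier with symbol `|y|`, with domain the `f` for
which `|y| 𝓕f(y)` is square integrable (that is, `H¹(ℝ)`); it is set to `0` off its domain. -/
def absD (f : L2) : L2 :=
  open scoped Classical in
  if h : MemLp (absDSymbol f) 2 volume then (𝓕⁻ (h.toLp (absDSymbol f) : L2) : L2) else 0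

/-- The operator `𝒟 = 1 + (β/γ) √μ |D|`. -/
def opD (γ β μ : ℝ) (f : L2) : L2 :=
  f + (β / γ * Real.sqrt μ) • absD f

/-- The operator `ℬ = (1/γ) (1 + ((β - 1)/γ) √μ |D|)`. -/
def opB (γ β μ : ℝ) (f : L2) : L2 :=
  (1 / γ) • (f + ((β - 1) / γ * Real.sqrt μ) • absD f)

/-- `(ξ, ν)` is the profile of a solitary wave of speed `c`, in `H¹(ℝ) × H¹(ℝ)`, of the
Benjamin-Ono system: both components are (the continuous representatives of) functions in `H¹(ℝ)`
and `-c 𝒟 ξ + ℬ ν = (ε/γ) ξ ν`, `ξ = (1/(1-γ)) (c ν + (ε/(2γ)) ν²)`. The first equation is an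
equation in `L²(ℝ)`. -/
structure IsSolitaryWave (γ β μ ε c : ℝ) (ξ ν : ℝ → ℝ) : Prop where
  continuous_fst : Continuous ξ
  continuous_snd : Continuous ν
  memH1_fst : MemH1 ξ
  memH1_snd : MemH1 ν
  eq_fst : ∀ᵐ x : ℝ,
    ((-c) • opD γ β μ (toL2 ξ) + opB γ β μ (toL2 ν) : L2) x = ((ε / γ * (ξ x * ν x) : ℝ) : ℂ)
  eq_snd : ∀ x : ℝ, ξ x = 1 / (1 - γ) * (c * ν x + ε / (2 * γ) * ν x ^ 2)

/-- Every function in `H¹(ℝ)` lies in the domain of `|D|`. -/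
theorem MemH1.memLp_absDSymbol {f : ℝ → ℝ} (hf : MemH1 f) :
    MemLp (absDSymbol (toL2 f)) 2 volume := by
  obtain ⟨u, hu⟩ := TemperedDistribution.memSobolev_iff_exists_smulLeftCLM_fourier.mp hf.memSobolev
  set g : ℝ → ℂ := fun x => (((1 + ‖x‖ ^ 2) ^ (-(1 : ℝ) / 2) : ℝ) : ℂ) with hg
  have hgt : g.HasTemperateGrowth := by fun_prop
  have hgb : MemLp g ∞ (volume : Measure ℝ) := by
    refine memLp_top_of_bound hgt.1.continuous.aestronglyMeasurable 1 (Filter.Eventually.of_forall ?_)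
    intro x
    rw [hg, Complex.norm_real, Real.norm_eq_abs, abs_of_nonneg (by positivity)]
    exact Real.rpow_le_one_of_one_le_of_nonpos (by simp [sq_nonneg]) (by norm_num)
  have h1 : ((𝓕 (toL2 f) : L2) : 𝓢'(ℝ, ℂ)) = ((hgb.toLp g • u : L2) : 𝓢'(ℝ, ℂ)) := by
    have h0 : (fun x : ℝ => (((1 + ‖x‖ ^ 2) ^ ((1 : ℝ) / 2) : ℝ) : ℂ)) * g = fun _ => 1 := by
      ext x
      rw [Pi.mul_apply, hg, ← Complex.ofReal_mul, ← Real.rpow_add (by positivity)]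
      norm_num
    rw [Lp.toTemperedDistribution_smul_eq hgt, ← hu,
      TemperedDistribution.smulLeftCLM_smulLeftCLM_apply (by fun_prop) hgt,
      h0, TemperedDistribution.smulLeftCLM_const, one_smul, Lp.fourier_toTemperedDistribution_eq]
  have h2 : (𝓕 (toL2 f) : L2) = hgb.toLp g • u :=
    LinearMap.ker_eq_bot.mp (Lp.ker_toTemperedDistributionCLM_eq_bot
      (E := ℝ) (F := ℂ) (μ := volume) (p := 2)) h1
  have h3 : ∀ᵐ y : ℝ, (𝓕 (toL2 f) : L2) y = g y * u y := by
    rw [h2]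
    filter_upwards [Lp.coeFn_lpSMul (r := 2) (hgb.toLp g) u, hgb.coeFn_toLp] with x hx hx'
    simp [hx, hx']
  refine ((Lp.memLp u).const_mul ((2 * Real.pi : ℝ) : ℂ)).mono ?_ ?_
  · refine AEStronglyMeasurable.mul ?_ (Lp.aestronglyMeasurable _)
    exact (by fun_prop : Continuous fun y : ℝ => ((|2 * Real.pi * y| : ℝ) : ℂ)).aestronglyMeasurable
  · filter_upwards [h3] with y hy
    have hπ := Real.pi_pos
    have h4 : |y| * (1 + ‖y‖ ^ 2) ^ (-(1 : ℝ) / 2) ≤ 1 := by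
      have h5 : (1 + ‖y‖ ^ 2) ^ (-(1 : ℝ) / 2) = (Real.sqrt (1 + y ^ 2))⁻¹ := by
        rw [Real.norm_eq_abs, sq_abs, Real.sqrt_eq_rpow, ← Real.rpow_neg (by positivity)]
        norm_num
      rw [h5, ← div_eq_mul_inv, div_le_one (by positivity)]
      exact Real.abs_le_sqrt (by linarith)
    rw [absDSymbol, hy, hg]
    simp only [norm_mul, Complex.norm_real, Real.norm_eq_abs y]
    rw [Real.norm_of_nonneg (abs_nonneg _), abs_mul, Real.norm_of_nonneg hπ.le, Real.norm_two,
      abs_of_pos (show 0 < 2 * Real.pi by positivity),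
      Real.norm_of_nonneg (show 0 ≤ (1 + |y| ^ 2) ^ (-(1 : ℝ) / 2) by positivity)]
    rw [Real.norm_eq_abs] at h4
    calc _ = 2 * Real.pi * ‖u y‖ * (|y| * (1 + |y| ^ 2) ^ (-(1 : ℝ) / 2)) := by ring
      _ ≤ 2 * Real.pi * ‖u y‖ * 1 := by gcongr
      _ = _ := by ring

end

end BenjaminOno

/-!
Eliminating `ξ` from the system, the component `ν` satisfies
`(p + q|D|)ν = r|D|ν² + sν² + wν³` with constants `p, q > 0`; their positivity is the hypothesis on
the speed. Since `r|D|ν² = (r/q)((p + q|D|)ν² - pν²)`, this is equivalent to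
`ν - (r/q)ν² = k ⋆ (σν² + wν³)`, where `k` is the kernel with symbol `1/(p + q|D|)`
(`IsSolitaryWave.exists_eq_integral`).

The kernel is `k = ∫₀^∞ exp (-pt) P_t dt` with `P_t` the Poisson kernels (`resolventKernel`), which
shows that it is nonnegative, integrable and at most a constant times `1/x²`. Its logarithmic
singularity at the origin is harmless.

As `ν` is in `H¹`, its Fourier transform is integrable, so `ν` tends to `0` at infinity by the
Riemann-Lebesgue lemma (`MemH1.tendsto_cocompact`). Hence far out the left-hand side of the integral
equation is at least `|ν|/2`, and `|ν|` is dominated by a multiple of `k ⋆ ν²`. Convolution with `k`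
preserves decay like `1/x²`, and one of the two factors `ν` in `ν²` is small far out; an absorption
argument in a weighted supremum norm (`exists_sq_mul_abs_le`) then gives the decay of `ν`. That of
`ξ` follows from the second equation.

The Fourier transform in the statement is that of `L²`, while the convolution theorem and the
Riemann-Lebesgue lemma concern the Fourier integral; the two are compared as tempered distributions.
-/

namespace BenjaminOno

open Filter Topology Real

/-! ### The Fourier transform of `L²` and the Fourier integral -/

/-- Locally integrable functions that agree as tempered distributions agree almost everywhere. -/
theorem ae_eq_of_integral_schwartzMap_eq {f g : ℝ → ℂ} (hf : LocallyIntegrable f)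
    (hg : LocallyIntegrable g)
    (h : ∀ φ : 𝓢(ℝ, ℂ), ∫ x, φ x • f x = ∫ x, φ x • g x) : f =ᵐ[volume] g := by
  refine ae_eq_of_integral_contDiff_smul_eq hf hg fun φ hφ hc => ?_
  have h1 : HasCompactSupport (Complex.ofRealCLM ∘ φ) := hc.comp_left rfl
  have h2 : ContDiff ℝ (⊤ : ℕ∞) (Complex.ofRealCLM ∘ φ) :=
    Complex.ofRealCLM.contDiff.comp hφ
  simpa using h (h1.toSchwartzMap h2)

theorem integral_schwartzMap_smul_fourier_Lp (φ : 𝓢(ℝ, ℂ)) (f : L2) :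
    ∫ x, φ x • (𝓕 f : L2) x = ∫ x, (𝓕 φ) x • f x := by
  rw [← Lp.toTemperedDistribution_apply, ← Lp.fourier_toTemperedDistribution_eq,
    TemperedDistribution.fourier_apply, Lp.toTemperedDistribution_apply]

theorem integral_schwartzMap_smul_fourier (φ : 𝓢(ℝ, ℂ)) {f : ℝ → ℂ} (hf : Integrable f) :
    ∫ x, φ x • 𝓕 f x = ∫ x, (𝓕 φ) x • f x := by
  simpa using! (VectorFourier.integral_fourierIntegral_smul_eq_flip (L := innerₗ ℝ)
    Real.continuous_fourierChar continuous_inner φ.integrable hf).symm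

theorem continuous_fourier {f : ℝ → ℂ} (hf : Integrable f) : Continuous (𝓕 f) :=
  VectorFourier.fourierIntegral_continuous Real.continuous_fourierChar
    (by exact continuous_inner) hf

theorem locallyIntegrable_Lp (f : L2) : LocallyIntegrable f :=
  (Lp.memLp f).locallyIntegrable (by norm_num)

/-- On `L¹ ∩ L²` the Fourier transform of `L²` is given by the Fourier integral. -/
theorem fourier_toLp_ae_eq {f : ℝ → ℂ} (hf : MemLp f 2) (hf1 : Integrable f) :
    (𝓕 (hf.toLp f) : L2) =ᵐ[volume] 𝓕 f := by
  refine ae_eq_of_integral_schwartzMap_eq (locallyIntegrable_Lp _)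
    (continuous_fourier hf1).locallyIntegrable fun φ => ?_
  rw [integral_schwartzMap_smul_fourier_Lp, integral_schwartzMap_smul_fourier φ hf1]
  refine integral_congr_ae ?_
  filter_upwards [hf.coeFn_toLp] with x hx
  rw [hx]

/-- An element of `L²` and an integrable function with the same Fourier transform agree. -/
theorem ae_eq_of_fourier_ae_eq {f : L2} {g : ℝ → ℂ} (hg : Integrable g)
    (h : (𝓕 f : L2) =ᵐ[volume] 𝓕 g) : f =ᵐ[volume] g := by
  refine ae_eq_of_integral_schwartzMap_eq (locallyIntegrable_Lp _) hg.locallyIntegrable fun φ => ?_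
  have h1 := integral_schwartzMap_smul_fourier_Lp (𝓕⁻ φ) f
  have h2 := integral_schwartzMap_smul_fourier (𝓕⁻ φ) hg
  rw [FourierTransform.fourier_fourierInv_eq] at h1 h2
  rw [← h1, ← h2]
  refine integral_congr_ae ?_
  filter_upwards [h] with x hx
  rw [hx]

/-- An element of `L²` whose Fourier transform is integrable is given by the inversion integral. -/
theorem ae_eq_fourierInv_of_integrable_fourier {f : L2} (hf : Integrable (𝓕 f : L2)) :
    f =ᵐ[volume] 𝓕⁻ ((𝓕 f : L2) : ℝ → ℂ) := by
  have hn : Integrable fun x => (𝓕 f : L2) (-x) := hf.comp_neg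
  rw [Real.fourierInv_eq_fourier_comp_neg]
  refine ae_eq_of_integral_schwartzMap_eq (locallyIntegrable_Lp _)
    (continuous_fourier hn).locallyIntegrable fun φ => ?_
  rw [integral_schwartzMap_smul_fourier φ hn]
  have h1 := integral_schwartzMap_smul_fourier_Lp (𝓕⁻ φ) f
  rw [FourierTransform.fourier_fourierInv_eq] at h1
  rw [← h1, ← integral_neg_eq_self]
  refine integral_congr_ae (.of_forall fun x => ?_)
  simp only [SchwartzMap.fourierInv_coe, SchwartzMap.fourier_coe, Real.fourierInv_eq_fourier_neg, neg_neg]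

/-! ### The Poisson kernel and the resolvent kernel of `|D|` -/

/-- The Poisson kernel of the half-plane at height `a / 2π`, that is the Fourier transform of
`y ↦ exp (-a|y|)` for the kernel `exp (-2πixy)`. -/
noncomputable def poisson (a x : ℝ) : ℝ := 2 * a / (a ^ 2 + 4 * π ^ 2 * x ^ 2)

theorem integrable_exp_neg_mul_abs {a : ℝ} (ha : 0 < a) :
    Integrable fun y : ℝ => (rexp (-(a * |y|)) : ℂ) := by
  have h : Integrable fun y : ℝ => rexp (-(a * |y|)) := by
    rw [← integrableOn_univ, ← Set.Iic_union_Ioi (a := (0 : ℝ))]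
    refine IntegrableOn.union ?_ ?_
    · refine (integrableOn_exp_mul_Iic ha 0).congr_fun (fun y hy => ?_) measurableSet_Iic
      simp only [abs_of_nonpos (Set.mem_Iic.1 hy), mul_neg, neg_neg]
    · refine (integrableOn_exp_mul_Ioi (neg_lt_zero.2 ha) 0).congr_fun (fun y hy => ?_)
        measurableSet_Ioi
      simp only [abs_of_pos (Set.mem_Ioi.1 hy), neg_mul]
  exact h.ofReal

theorem fourier_exp_neg_mul_abs {a : ℝ} (ha : 0 < a) (x : ℝ) :
    𝓕 (fun y : ℝ => (rexp (-(a * |y|)) : ℂ)) x = poisson a x := by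
  have hi : Integrable fun y : ℝ => Complex.exp (↑(-2 * π * y * x) * Complex.I) •
      (rexp (-(a * |y|)) : ℂ) := by
    refine (integrable_exp_neg_mul_abs ha).mono (by fun_prop) (.of_forall fun y => ?_)
    rw [norm_smul, Complex.norm_exp_ofReal_mul_I, one_mul]
  have hr : (-a - 2 * π * x * Complex.I : ℂ).re < 0 := by simpa using ha
  have hl : 0 < (a - 2 * π * x * Complex.I : ℂ).re := by simpa using ha
  rw [fourier_real_eq_integral_exp_smul, ← intervalIntegral.integral_Iic_add_Ioi (b := 0)
    hi.integrableOn hi.integrableOn]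
  have h1 : ∫ y in Set.Iic (0 : ℝ), Complex.exp (↑(-2 * π * y * x) * Complex.I) •
      (rexp (-(a * |y|)) : ℂ) = ∫ y in Set.Iic (0 : ℝ),
        Complex.exp ((a - 2 * π * x * Complex.I) * y) := by
    refine setIntegral_congr_fun measurableSet_Iic fun y hy => ?_
    simp only [smul_eq_mul, abs_of_nonpos (Set.mem_Iic.1 hy), Complex.ofReal_exp, ← Complex.exp_add]
    congr 1; push_cast; ring
  have h2 : ∫ y in Set.Ioi (0 : ℝ), Complex.exp (↑(-2 * π * y * x) * Complex.I) •
      (rexp (-(a * |y|)) : ℂ) = ∫ y in Set.Ioi (0 : ℝ),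
        Complex.exp ((-a - 2 * π * x * Complex.I) * y) := by
    refine setIntegral_congr_fun measurableSet_Ioi fun y hy => ?_
    simp only [smul_eq_mul, abs_of_pos (Set.mem_Ioi.1 hy), Complex.ofReal_exp, ← Complex.exp_add]
    congr 1; push_cast; ring
  rw [h1, h2, integral_exp_mul_complex_Iic hl, integral_exp_mul_complex_Ioi hr, poisson]
  have hl0 : (a - 2 * π * x * Complex.I : ℂ) ≠ 0 := fun h => by simp [h] at hl
  have hr0 : (-a - 2 * π * x * Complex.I : ℂ) ≠ 0 := fun h => by simp [h] at hr
  have hd : (a ^ 2 + 4 * π ^ 2 * x ^ 2 : ℂ) ≠ 0 := by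
    have : 0 < a ^ 2 + 4 * π ^ 2 * x ^ 2 := by positivity
    exact_mod_cast this.ne'
  push_cast
  simp only [mul_zero, Complex.exp_zero]
  rw [div_add_div _ _ hl0 hr0, div_eq_div_iff (mul_ne_zero hl0 hr0) hd]
  linear_combination (-8 * a * π ^ 2 * x ^ 2 : ℂ) * Complex.I_sq

theorem poisson_nonneg {a : ℝ} (ha : 0 ≤ a) (x : ℝ) : 0 ≤ poisson a x := by
  unfold poisson; positivity

theorem sq_mul_poisson_le {a : ℝ} (ha : 0 ≤ a) (x : ℝ) : x ^ 2 * poisson a x ≤ a := by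
  unfold poisson
  have := Real.pi_gt_three
  rcases ha.eq_or_lt with rfl | ha
  · simp
  · rw [mul_div_assoc', div_le_iff₀ (by positivity)]
    have h9 : 9 ≤ π ^ 2 := by nlinarith
    nlinarith [mul_nonneg ha.le (sq_nonneg x), pow_pos ha 3,
      mul_le_mul_of_nonneg_left h9 (mul_nonneg ha.le (sq_nonneg x))]

theorem integrable_poisson {a : ℝ} (ha : 0 < a) : Integrable (poisson a) := by
  have h := (integrable_inv_one_add_sq.comp_mul_left' (show 2 * π / a ≠ 0 by positivity)).const_mul
    (2 / a)
  refine h.congr (.of_forall fun x => ?_)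
  simp only [poisson]
  field_simp
  ring

/-- By Fourier inversion, as `poisson a` is the Fourier transform of `y ↦ exp (-a|y|)`. -/
theorem fourier_poisson {a : ℝ} (ha : 0 < a) (y : ℝ) :
    𝓕 (fun x : ℝ => (poisson a x : ℂ)) y = rexp (-(a * |y|)) := by
  have hc : Continuous fun y : ℝ => (rexp (-(a * |y|)) : ℂ) := by fun_prop
  have hF : 𝓕 (fun y : ℝ => (rexp (-(a * |y|)) : ℂ)) = fun x => (poisson a x : ℂ) :=
    funext fun x => fourier_exp_neg_mul_abs ha x
  have h := hc.fourierInv_fourier_eq (integrable_exp_neg_mul_abs ha)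
    (by rw [hF]; exact (integrable_poisson ha).ofReal)
  rw [hF] at h
  have := congrFun h (-y)
  rw [fourierInv_eq_fourier_neg, neg_neg] at this
  simpa using this

/-- The integral is the value at `0` of the Fourier transform. -/
theorem integral_poisson {a : ℝ} (ha : 0 < a) : ∫ x, poisson a x = 1 := by
  have h := fourier_poisson ha 0
  rw [fourier_real_eq_integral_exp_smul] at h
  simp only [mul_zero, Complex.ofReal_zero, zero_mul, Complex.exp_zero, one_smul, abs_zero,
    neg_zero, Real.exp_zero] at h
  rw [integral_complex_ofReal] at h
  exact_mod_cast h

/-- The convolution kernel with symbol `1/(p + b|y|)` (see `fourier_resolventKernel`), written as the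
Laplace transform in `t` of the Poisson kernels with symbol `exp (-bt|y|)`. The integral diverges at
`x = 0`, where the value is therefore `0`. -/
noncomputable def resolventKernel (p b x : ℝ) : ℝ :=
  ∫ t in Set.Ioi (0 : ℝ), rexp (-(p * t)) * poisson (b * t) x

variable {p b : ℝ}

theorem resolventKernel_nonneg (hb : 0 < b) (x : ℝ) : 0 ≤ resolventKernel p b x :=
  setIntegral_nonneg measurableSet_Ioi fun _ ht =>
    mul_nonneg (exp_pos _).le (poisson_nonneg (mul_pos hb ht).le x)

theorem integrableOn_exp_neg_mul {p : ℝ} (hp : 0 < p) :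
    IntegrableOn (fun t : ℝ => rexp (-(p * t))) (Set.Ioi 0) := by
  simpa using integrableOn_exp_mul_Ioi (neg_lt_zero.2 hp) 0

theorem integral_exp_neg_mul {p : ℝ} (hp : 0 < p) :
    ∫ t in Set.Ioi (0 : ℝ), rexp (-(p * t)) = p⁻¹ := by
  have := integral_exp_mul_Ioi (neg_lt_zero.2 hp) 0
  simpa [one_div] using this

theorem integrable_exp_mul_poisson (hp : 0 < p) (hb : 0 < b) :
    Integrable (fun z : ℝ × ℝ => rexp (-(p * z.1)) * poisson (b * z.1) z.2)
      ((volume.restrict (Set.Ioi 0)).prod volume) := by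
  have hm : Measurable fun z : ℝ × ℝ => rexp (-(p * z.1)) * poisson (b * z.1) z.2 := by
    unfold poisson; fun_prop
  rw [integrable_prod_iff hm.aestronglyMeasurable]
  constructor
  · filter_upwards [ae_restrict_mem measurableSet_Ioi] with t ht
    exact (integrable_poisson (mul_pos hb ht)).const_mul _
  · refine (integrableOn_exp_neg_mul hp).congr ?_
    filter_upwards [ae_restrict_mem measurableSet_Ioi] with t ht
    have hbt := mul_pos hb ht
    have : ∀ y, ‖rexp (-(p * t)) * poisson (b * t) y‖ = rexp (-(p * t)) * poisson (b * t) y :=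
      fun y => Real.norm_of_nonneg (mul_nonneg (exp_pos _).le (poisson_nonneg hbt.le y))
    simp only [this]
    rw [integral_const_mul, integral_poisson hbt, mul_one]

theorem integrable_resolventKernel (hp : 0 < p) (hb : 0 < b) :
    Integrable (resolventKernel p b) :=
  (integrable_exp_mul_poisson hp hb).integral_prod_right

/-- The resolvent kernel decays like `1/x²`, as do the Poisson kernels it is built from. This is the
source of the decay rate of the solitary waves. -/
theorem exists_sq_mul_resolventKernel_le (hp : 0 < p) (hb : 0 < b) :
    ∃ C, ∀ x, x ^ 2 * resolventKernel p b x ≤ C := by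
  have hi : IntegrableOn (fun t : ℝ => rexp (-(p * t)) * (b * t)) (Set.Ioi 0) := by
    refine ((integrableOn_rpow_mul_exp_neg_mul_rpow (s := 1) (p := 1) (by norm_num) one_pos
      hp).const_mul b).congr (.of_forall fun t => ?_)
    simp only [Real.rpow_one, neg_mul]
    ring
  refine ⟨∫ t in Set.Ioi (0 : ℝ), rexp (-(p * t)) * (b * t), fun x => ?_⟩
  rw [resolventKernel, ← integral_const_mul]
  refine integral_mono_of_nonneg ?_ hi ?_
  · filter_upwards [ae_restrict_mem measurableSet_Ioi] with t ht
    exact mul_nonneg (sq_nonneg x)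
      (mul_nonneg (exp_pos _).le (poisson_nonneg (mul_pos hb ht).le x))
  · filter_upwards [ae_restrict_mem measurableSet_Ioi] with t ht
    have := mul_le_mul_of_nonneg_left (sq_mul_poisson_le (mul_pos hb ht).le x)
      (exp_pos (-(p * t))).le
    linarith

theorem fourier_resolventKernel (hp : 0 < p) (hb : 0 < b) (y : ℝ) :
    𝓕 (fun x => (resolventKernel p b x : ℂ)) y = ((p + b * |y|)⁻¹ : ℝ) := by
  have hint : Integrable (Function.uncurry fun (x t : ℝ) => Complex.exp (↑(-2 * π * x * y) * Complex.I) •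
      ((rexp (-(p * t)) * poisson (b * t) x : ℝ) : ℂ))
      (volume.prod (volume.restrict (Set.Ioi 0))) := by
    refine ((integrable_exp_mul_poisson hp hb).swap.ofReal (𝕜 := ℂ)).mono ?_ (.of_forall fun z => ?_)
    · unfold poisson
      exact Measurable.aestronglyMeasurable (by fun_prop)
    · simp only [Function.uncurry, norm_smul, Complex.norm_exp_ofReal_mul_I, one_mul,
        Function.comp, Prod.fst_swap, Prod.snd_swap]
      exact le_rfl
  have h1 : ∀ x, Complex.exp (↑(-2 * π * x * y) * Complex.I) • (resolventKernel p b x : ℂ) =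
      ∫ t in Set.Ioi (0 : ℝ), Complex.exp (↑(-2 * π * x * y) * Complex.I) •
        ((rexp (-(p * t)) * poisson (b * t) x : ℝ) : ℂ) := fun x => by
    rw [integral_smul, integral_complex_ofReal, resolventKernel]
  rw [fourier_real_eq_integral_exp_smul]
  simp_rw [h1]
  rw [integral_integral_swap hint]
  have h2 : ∀ t ∈ Set.Ioi (0 : ℝ), ∫ x, Complex.exp (↑(-2 * π * x * y) * Complex.I) •
      ((rexp (-(p * t)) * poisson (b * t) x : ℝ) : ℂ) = (rexp (-((p + b * |y|) * t)) : ℝ) := by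
    intro t ht
    have h3 := fourier_poisson (mul_pos hb ht) y
    rw [fourier_real_eq_integral_exp_smul] at h3
    have : ∀ x, Complex.exp (↑(-2 * π * x * y) * Complex.I) •
      ((rexp (-(p * t)) * poisson (b * t) x : ℝ) : ℂ) = (rexp (-(p * t)) : ℂ) *
        (Complex.exp (↑(-2 * π * x * y) * Complex.I) • (poisson (b * t) x : ℂ)) := by
      intro x; simp only [smul_eq_mul]; push_cast; ring
    simp_rw [this]
    rw [integral_const_mul, h3, ← Complex.ofReal_mul, ← Real.exp_add]
    congr 2; ring
  rw [setIntegral_congr_fun measurableSet_Ioi h2, integral_complex_ofReal,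
    integral_exp_neg_mul (by positivity)]

/-! ### Decay from a quadratic convolution inequality -/

theorem exists_abs_le_of_tendsto_cocompact {u : ℝ → ℝ} (hu : Continuous u)
    (hu0 : Tendsto u (cocompact ℝ) (𝓝 0)) : ∃ B, ∀ x, |u x| ≤ B := by
  obtain ⟨B, hB⟩ := isBounded_iff_forall_norm_le.1
    (ZeroAtInftyContinuousMap.isBounded_range (⟨⟨u, hu⟩, hu0⟩ : ZeroAtInftyContinuousMap ℝ ℝ))
  exact ⟨B, fun x => hB _ ⟨x, rfl⟩⟩

/-- A function that vanishes at infinity and is dominated, far out, by the convolution of its own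
square with a kernel that decays like `1/x²` decays like `1/x²` itself. The weighted supremum
`M = sup |u| / (δ + 1/(1 + x²))` is finite because `δ > 0`; as `u` is small far out, the convolution
contributes at most `M/2` to it, up to a constant, which bounds `M` uniformly in `δ`. -/
theorem exists_sq_mul_abs_le {k u : ℝ → ℝ} (hk0 : ∀ x, 0 ≤ k x) (hk : Integrable k)
    {C : ℝ} (hkC : ∀ x, x ^ 2 * k x ≤ C) (hu : Continuous u)
    (hu0 : Tendsto u (cocompact ℝ) (𝓝 0)) {A R : ℝ} (hA : 0 ≤ A)
    (h : ∀ x, R ≤ |x| → |u x| ≤ A * ∫ t, k t * u (x - t) ^ 2) :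
    ∃ N, ∀ x, x ^ 2 * |u x| ≤ N := by
  obtain ⟨B, hB⟩ := exists_abs_le_of_tendsto_cocompact hu hu0
  have hB0 : 0 ≤ B := (abs_nonneg _).trans (hB 0)
  have hC0 : 0 ≤ C := (mul_nonneg (sq_nonneg _) (hk0 0)).trans (hkC 0)
  set J := ∫ t, k t with hJ
  have hJ0 : 0 ≤ J := integral_nonneg hk0
  -- The kernel maps the weight `δ + 1 / (1 + x²)` to a multiple of itself, uniformly in `δ`.
  set K := 3 * J + 2 * C * Real.pi with hK
  have hK0 : 0 ≤ K := by have := Real.pi_pos; positivity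
  have hint : ∀ δ x : ℝ, 0 ≤ δ → Integrable fun t => k t * (δ + (1 + (x - t) ^ 2)⁻¹) := by
    intro δ x hδ
    refine hk.mul_bdd (c := δ + 1) (Measurable.aestronglyMeasurable (by fun_prop))
      (.of_forall fun t => ?_)
    rw [Real.norm_of_nonneg (by positivity)]
    have : (1 + (x - t) ^ 2)⁻¹ ≤ 1 := inv_le_one_of_one_le₀ (by nlinarith [sq_nonneg (x - t)])
    linarith
  have hconv : ∀ δ x : ℝ, 0 ≤ δ →
      ∫ t, k t * (δ + (1 + (x - t) ^ 2)⁻¹) ≤ K * (δ + (1 + x ^ 2)⁻¹) := by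
    intro δ x hδ
    have hi : Integrable fun t => (1 + (x - t) ^ 2)⁻¹ := integrable_inv_one_add_sq.comp_sub_left x
    have hpt : ∀ t, k t * (δ + (1 + (x - t) ^ 2)⁻¹) ≤
        (δ + 2 * (1 + x ^ 2)⁻¹) * k t + 2 * C * (1 + x ^ 2)⁻¹ * (1 + (x - t) ^ 2)⁻¹ := by
      intro t
      have h1 : k t * (1 + (x - t) ^ 2)⁻¹ ≤
          2 * (1 + x ^ 2)⁻¹ * k t + 2 * C * (1 + x ^ 2)⁻¹ * (1 + (x - t) ^ 2)⁻¹ := by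
        have hx : 0 < 1 + x ^ 2 := by positivity
        have hy : 0 < 1 + (x - t) ^ 2 := by positivity
        -- `1 + x² ≤ 2(1 + (x - t)²) + 2t²` splits the weight between the two factors.
        have h2 : k t * (1 + x ^ 2) ≤ 2 * k t * (1 + (x - t) ^ 2) + 2 * C := by
          nlinarith [hkC t, hk0 t, mul_nonneg (hk0 t) (sq_nonneg (x - 2 * t))]
        have h3 := mul_le_mul_of_nonneg_right h2
          (mul_nonneg (inv_nonneg.2 hx.le) (inv_nonneg.2 hy.le))
        calc k t * (1 + (x - t) ^ 2)⁻¹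
            = k t * (1 + x ^ 2) * ((1 + x ^ 2)⁻¹ * (1 + (x - t) ^ 2)⁻¹) := by field_simp
          _ ≤ _ := h3
          _ = _ := by field_simp
      linarith
    calc _ ≤ ∫ t, ((δ + 2 * (1 + x ^ 2)⁻¹) * k t +
          2 * C * (1 + x ^ 2)⁻¹ * (1 + (x - t) ^ 2)⁻¹) :=
          integral_mono (hint δ x hδ) ((hk.const_mul _).add (hi.const_mul _)) hpt
      _ = (δ + 2 * (1 + x ^ 2)⁻¹) * J + 2 * C * (1 + x ^ 2)⁻¹ * Real.pi := by
          rw [integral_add (hk.const_mul _) (hi.const_mul _), integral_const_mul,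
            integral_const_mul, integral_sub_left_eq_self (fun t => (1 + t ^ 2)⁻¹),
            integral_univ_inv_one_add_sq]
      _ ≤ _ := by
          have := Real.pi_pos
          have hx : 0 ≤ (1 + x ^ 2)⁻¹ := by positivity
          rw [hK]
          nlinarith [mul_nonneg hδ hJ0, mul_nonneg hδ (mul_nonneg hC0 this.le),
            mul_nonneg hx hJ0]
  -- Far out `u` is small, which is what makes the quadratic term absorbable.
  obtain ⟨η, hη, hη'⟩ : ∃ η : ℝ, 0 < η ∧ A * K * η ≤ 1 / 2 := by
    refine ⟨(2 * (A * K + 1))⁻¹, by positivity, ?_⟩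
    rw [← div_eq_mul_inv, div_le_div_iff₀ (by positivity) two_pos]
    linarith [mul_nonneg hA hK0]
  obtain ⟨r, hr⟩ : ∃ r : ℝ, ∀ x, r < |x| → |u x| ≤ η := by
    have h1 : ∀ᶠ x in cocompact ℝ, |u x| ≤ η := by
      have := hu0.abs
      rw [abs_zero] at this
      exact this.eventually (Iic_mem_nhds hη)
    rw [← Metric.cobounded_eq_cocompact, ← comap_norm_atTop, eventually_comap] at h1
    obtain ⟨r, hr⟩ := eventually_atTop.1 h1
    exact ⟨r, fun x hx => hr _ hx.le x rfl⟩
  set E := B ^ 2 * (1 + r ^ 2) with hE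
  set D := A * K * E + B * (1 + R ^ 2) with hD
  have hmain : ∀ δ : ℝ, 0 < δ → ∀ x, |u x| ≤ 2 * D * (δ + (1 + x ^ 2)⁻¹) := by
    intro δ hδ
    have hρ : ∀ x : ℝ, 0 < δ + (1 + x ^ 2)⁻¹ := fun x => by positivity
    set M := ⨆ x, |u x| / (δ + (1 + x ^ 2)⁻¹) with hM
    have hbdd : BddAbove (Set.range fun x => |u x| / (δ + (1 + x ^ 2)⁻¹)) := by
      refine ⟨B / δ, ?_⟩
      rintro _ ⟨x, rfl⟩
      have : 0 ≤ (1 + x ^ 2)⁻¹ := by positivity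
      exact div_le_div₀ hB0 (hB x) hδ (by linarith)
    have huM : ∀ x, |u x| ≤ M * (δ + (1 + x ^ 2)⁻¹) := fun x =>
      (div_le_iff₀ (hρ x)).1 (le_ciSup hbdd x)
    have hM0 : 0 ≤ M := Real.iSup_nonneg fun x => div_nonneg (abs_nonneg _) (hρ x).le
    have hsq : ∀ y, u y ^ 2 ≤ (η * M + E) * (δ + (1 + y ^ 2)⁻¹) := by
      intro y
      have hy : 0 < (1 + y ^ 2)⁻¹ := by positivity
      rcases lt_or_ge r |y| with hy1 | hy1
      · have h1 : u y ^ 2 ≤ η * (M * (δ + (1 + y ^ 2)⁻¹)) := by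
          rw [← sq_abs, sq]
          exact mul_le_mul (hr y hy1) (huM y) (abs_nonneg _) hη.le
        have h2 : 0 ≤ E * (δ + (1 + y ^ 2)⁻¹) := by have := hρ y; positivity
        linarith
      · have h1 : u y ^ 2 ≤ B ^ 2 := by
          rw [← sq_abs]; exact pow_le_pow_left₀ (abs_nonneg _) (hB y) 2
        have h2 : y ^ 2 ≤ r ^ 2 := by
          rw [← sq_abs]; exact pow_le_pow_left₀ (abs_nonneg _) hy1 2
        have h3 : B ^ 2 ≤ E * (1 + y ^ 2)⁻¹ := by
          rw [← div_eq_mul_inv, le_div_iff₀ (by positivity), hE]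
          gcongr
        have h4 : 0 ≤ η * M * (δ + (1 + y ^ 2)⁻¹) := by have := hρ y; positivity
        have h5 : 0 ≤ E * δ := by positivity
        linarith
    have hstep : ∀ x, |u x| ≤ (M / 2 + D) * (δ + (1 + x ^ 2)⁻¹) := by
      intro x
      have hEM : 0 ≤ η * M + E := by positivity
      rcases le_or_gt R |x| with hx | hx
      · have h1 : ∫ t, k t * u (x - t) ^ 2 ≤ (η * M + E) * (K * (δ + (1 + x ^ 2)⁻¹)) := by
          calc _ ≤ ∫ t, (η * M + E) * (k t * (δ + (1 + (x - t) ^ 2)⁻¹)) := by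
                refine integral_mono_of_nonneg (.of_forall fun t => mul_nonneg (hk0 t)
                  (sq_nonneg _)) ((hint δ x hδ.le).const_mul _) (.of_forall fun t => ?_)
                have := mul_le_mul_of_nonneg_left (hsq (x - t)) (hk0 t)
                simp only
                linarith
            _ ≤ _ := by
                rw [integral_const_mul]
                exact mul_le_mul_of_nonneg_left (hconv δ x hδ.le) hEM
        have h2 := (h x hx).trans (mul_le_mul_of_nonneg_left h1 hA)
        have h3 : A * K * η * (M * (δ + (1 + x ^ 2)⁻¹)) ≤ 1 / 2 * (M * (δ + (1 + x ^ 2)⁻¹)) :=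
          mul_le_mul_of_nonneg_right hη' (mul_nonneg hM0 (hρ x).le)
        have h4 : 0 ≤ B * (1 + R ^ 2) * (δ + (1 + x ^ 2)⁻¹) :=
          mul_nonneg (by positivity) (hρ x).le
        rw [hD]
        linarith
      · have h2 : x ^ 2 ≤ R ^ 2 := by
          rw [← sq_abs]; exact pow_le_pow_left₀ (abs_nonneg _) hx.le 2
        have h3 : B ≤ B * (1 + R ^ 2) * (1 + x ^ 2)⁻¹ := by
          rw [← div_eq_mul_inv, le_div_iff₀ (by positivity)]
          gcongr
        have h4 : 0 ≤ (M / 2 + A * K * E) * (δ + (1 + x ^ 2)⁻¹) :=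
          mul_nonneg (by positivity) (hρ x).le
        have h5 : 0 ≤ B * (1 + R ^ 2) * δ := by positivity
        have := hB x
        rw [hD]
        linarith
    have hMD : M ≤ M / 2 + D := ciSup_le fun x => (div_le_iff₀ (hρ x)).2 (hstep x)
    exact fun x => (huM x).trans (mul_le_mul_of_nonneg_right (by linarith) (hρ x).le)
  refine ⟨2 * D, fun x => ?_⟩
  have hlim : |u x| ≤ 2 * D * (0 + (1 + x ^ 2)⁻¹) := by
    have ht : Tendsto (fun δ : ℝ => 2 * D * (δ + (1 + x ^ 2)⁻¹)) (𝓝[>] 0)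
        (𝓝 (2 * D * (0 + (1 + x ^ 2)⁻¹))) :=
      ((by fun_prop : Continuous fun δ : ℝ => 2 * D * (δ + (1 + x ^ 2)⁻¹)).tendsto 0).mono_left
        nhdsWithin_le_nhds
    exact ge_of_tendsto ht (by filter_upwards [self_mem_nhdsWithin] with δ hδ using hmain δ hδ x)
  rw [zero_add, ← div_eq_mul_inv, le_div_iff₀ (by positivity)] at hlim
  linarith [abs_nonneg (u x)]

/-! ### Fourier multipliers and functions in `H¹` -/

theorem toL2_ae_eq {f : ℝ → ℝ} (hf : MemLp (fun x => (f x : ℂ)) 2 volume) :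
    toL2 f =ᵐ[volume] fun x => (f x : ℂ) := by
  rw [toL2, dif_pos hf]
  exact hf.coeFn_toLp

theorem memLp_ofReal_iff {f : ℝ → ℝ} :
    MemLp (fun x => (f x : ℂ)) 2 volume ↔ MemLp f 2 volume :=
  ⟨fun h => by simpa using h.re, fun h => h.ofReal⟩

theorem fourier_add_ae_eq (f g : L2) :
    (𝓕 (f + g) : L2) =ᵐ[volume] fun y => (𝓕 f : L2) y + (𝓕 g : L2) y := by
  rw [FourierTransform.fourier_add]
  exact Lp.coeFn_add _ _

theorem fourier_smul_ae_eq (r : ℝ) (f : L2) :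
    (𝓕 (r • f) : L2) =ᵐ[volume] fun y => (r : ℂ) * (𝓕 f : L2) y := by
  have h : r • f = (r : ℂ) • f := RCLike.real_smul_eq_coe_smul (K := ℂ) r f
  rw [h, FourierTransform.fourier_smul]
  filter_upwards [Lp.coeFn_smul (r : ℂ) (𝓕 f : L2)] with y hy
  rw [hy]; rfl

theorem fourier_absD_ae_eq {f : L2} (hf : MemLp (absDSymbol f) 2 volume) :
    (𝓕 (absD f) : L2) =ᵐ[volume] absDSymbol f := by
  rw [absD, dif_pos hf, FourierTransform.fourier_fourierInv_eq]
  exact hf.coeFn_toLp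

theorem integrable_fourier_of_memLp_absDSymbol {f : L2} (hf : MemLp (absDSymbol f) 2 volume) :
    Integrable (𝓕 f : L2) := by
  have h1 : MemLp (fun y : ℝ => (1 + ((|2 * Real.pi * y| : ℝ) : ℂ)) * (𝓕 f : L2) y) 2 volume := by
    have := (Lp.memLp (𝓕 f : L2)).add hf
    refine this.ae_eq (.of_forall fun y => ?_)
    simp only [Pi.add_apply, absDSymbol]
    ring
  have h2 : MemLp (fun y : ℝ => (((1 + |2 * Real.pi * y|)⁻¹ : ℝ) : ℂ)) 2 volume := by
    rw [memLp_ofReal_iff, memLp_two_iff_integrable_sq (Measurable.aestronglyMeasurable (by fun_prop))]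
    refine integrable_inv_one_add_sq.mono (Measurable.aestronglyMeasurable (by fun_prop))
      (.of_forall fun y => ?_)
    rw [Real.norm_of_nonneg (by positivity), Real.norm_of_nonneg (by positivity), inv_pow]
    refine inv_anti₀ (by positivity) ?_
    have := Real.pi_gt_three
    have h3 : |2 * Real.pi * y| ^ 2 = 4 * Real.pi ^ 2 * y ^ 2 := by rw [sq_abs]; ring
    have h9 : 1 ≤ 4 * Real.pi ^ 2 := by nlinarith
    nlinarith [abs_nonneg (2 * Real.pi * y), mul_le_mul_of_nonneg_right h9 (sq_nonneg y)]
  refine (h2.integrable_mul h1).congr (.of_forall fun y => ?_)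
  have : (1 + ((|2 * Real.pi * y| : ℝ) : ℂ)) ≠ 0 := by
    have : (0 : ℝ) < 1 + |2 * Real.pi * y| := by positivity
    exact_mod_cast this.ne'
  simp only [Pi.mul_apply]
  rw [← mul_assoc]
  push_cast
  rw [inv_mul_cancel₀ (by exact_mod_cast this), one_mul]

/-- Continuous functions in `H¹` vanish at infinity. -/
theorem MemH1.tendsto_cocompact {f : ℝ → ℝ} (hf : MemH1 f) (hc : Continuous f) :
    Tendsto f (cocompact ℝ) (𝓝 0) := by
  have hi := integrable_fourier_of_memLp_absDSymbol hf.memLp_absDSymbol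
  have h1 := (toL2_ae_eq hf.memLp).symm.trans (ae_eq_fourierInv_of_integrable_fourier hi)
  rw [Real.fourierInv_eq_fourier_comp_neg] at h1
  have h2 := (Continuous.ae_eq_iff_eq volume (by fun_prop) (continuous_fourier hi.comp_neg)).1 h1
  have h3 : Tendsto (fun x => (f x : ℂ)) (cocompact ℝ) (𝓝 0) := by
    rw [h2]; exact Real.zero_at_infty_fourier _
  exact (Complex.continuous_re.tendsto 0).comp h3

open Convolution in
/-- If `(p + b|y|) 𝓕f(y) = 𝓕g(y)`, then `f` is the convolution of `g` with the resolvent kernel, at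
every point. With the angular frequency `2π|y|` the operator inverted here is `p + (b/2π)|D|`. -/
theorem eq_integral_resolventKernel_mul {p b : ℝ} (hp : 0 < p) (hb : 0 < b) {f g : ℝ → ℝ}
    (hfc : Continuous f) (hf : MemLp (fun x => (f x : ℂ)) 2 volume)
    (hgc : Continuous g) (hgi : Integrable g) {B : ℝ} (hgB : ∀ x, |g x| ≤ B)
    (hg : MemLp (fun x => (g x : ℂ)) 2 volume)
    (h : ∀ᵐ y : ℝ, ((p + b * |y| : ℝ) : ℂ) * (𝓕 (toL2 f) : L2) y = (𝓕 (toL2 g) : L2) y) (x : ℝ) :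
    f x = ∫ t, resolventKernel p b t * g (x - t) := by
  set k : ℝ → ℂ := fun x => (resolventKernel p b x : ℂ) with hk
  set G : ℝ → ℂ := fun x => (g x : ℂ) with hG
  have hki : Integrable k := (integrable_resolventKernel hp hb).ofReal
  have hGi : Integrable G := hgi.ofReal
  have hGc : Continuous G := by fun_prop
  have h1 : toL2 f =ᵐ[volume] k ⋆[ContinuousLinearMap.mul ℂ ℂ] G := by
    refine ae_eq_of_fourier_ae_eq (hki.integrable_convolution _ hGi) ?_
    have h2 : (𝓕 (toL2 g) : L2) =ᵐ[volume] 𝓕 G := by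
      rw [toL2, dif_pos hg]
      exact fourier_toLp_ae_eq hg hGi
    filter_upwards [h, h2] with y hy hy2
    rw [Real.fourier_mul_convolution_eq hki hGi, hk, fourier_resolventKernel hp hb, ← hy2, ← hy,
      ← mul_assoc, ← Complex.ofReal_mul, inv_mul_cancel₀ (by positivity), Complex.ofReal_one,
      one_mul]
  have hcc : Continuous (k ⋆[ContinuousLinearMap.mul ℂ ℂ] G) := by
    refine BddAbove.continuous_convolution_right_of_integrable _ ⟨B, ?_⟩ hki hGc
    rintro _ ⟨y, rfl⟩
    simpa [hG] using hgB y
  have h3 := (Continuous.ae_eq_iff_eq volume (by fun_prop) hcc).1 ((toL2_ae_eq hf).symm.trans h1)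
  have h4 := congrFun h3 x
  simp only [convolution, ContinuousLinearMap.mul_apply', hk, hG, ← Complex.ofReal_mul] at h4
  rw [integral_complex_ofReal] at h4
  exact_mod_cast h4

theorem toL2_add {f g : ℝ → ℝ} (hf : MemLp (fun x => (f x : ℂ)) 2 volume)
    (hg : MemLp (fun x => (g x : ℂ)) 2 volume) :
    toL2 (fun x => f x + g x) = toL2 f + toL2 g := by
  have hfg : MemLp (fun x => ((f x + g x : ℝ) : ℂ)) 2 volume := by simpa using! hf.add hg
  refine Lp.ext ?_
  filter_upwards [toL2_ae_eq hf, toL2_ae_eq hg, toL2_ae_eq hfg, Lp.coeFn_add (toL2 f) (toL2 g)]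
    with x h1 h2 h3 h4
  rw [h4, Pi.add_apply, h1, h2, h3, Complex.ofReal_add]

theorem toL2_const_mul (r : ℝ) {f : ℝ → ℝ} (hf : MemLp (fun x => (f x : ℂ)) 2 volume) :
    toL2 (fun x => r * f x) = r • toL2 f := by
  have hrf : MemLp (fun x => ((r * f x : ℝ) : ℂ)) 2 volume := by
    simpa using! hf.const_mul (r : ℂ)
  refine Lp.ext ?_
  filter_upwards [toL2_ae_eq hf, toL2_ae_eq hrf, Lp.coeFn_smul r (toL2 f)] with x h1 h2 h3
  rw [h3, Pi.smul_apply, h1, h2, Complex.ofReal_mul, Complex.real_smul]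

theorem fourier_toL2_linear_combination_ae_eq (r s : ℝ) {f g : ℝ → ℝ}
    (hf : MemLp (fun x => (f x : ℂ)) 2 volume) (hg : MemLp (fun x => (g x : ℂ)) 2 volume) :
    (𝓕 (toL2 fun x => r * f x + s * g x) : L2) =ᵐ[volume]
      fun y => (r : ℂ) * (𝓕 (toL2 f) : L2) y + (s : ℂ) * (𝓕 (toL2 g) : L2) y := by
  have hrf : MemLp (fun x => ((r * f x : ℝ) : ℂ)) 2 volume := by
    simpa using! hf.const_mul (r : ℂ)
  have hsg : MemLp (fun x => ((s * g x : ℝ) : ℂ)) 2 volume := by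
    simpa using! hg.const_mul (s : ℂ)
  rw [toL2_add hrf hsg, toL2_const_mul r hf, toL2_const_mul s hg]
  filter_upwards [fourier_add_ae_eq (r • toL2 f) (s • toL2 g), fourier_smul_ae_eq r (toL2 f),
    fourier_smul_ae_eq s (toL2 g)] with y h1 h2 h3
  rw [h1, h2, h3]

theorem fourier_opD_ae_eq (γ β μ : ℝ) {f : L2} (hf : MemLp (absDSymbol f) 2 volume) :
    (𝓕 (opD γ β μ f) : L2) =ᵐ[volume]
      fun y => (1 + β / γ * Real.sqrt μ * |2 * Real.pi * y| : ℝ) * (𝓕 f : L2) y := by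
  rw [opD]
  filter_upwards [fourier_add_ae_eq f ((β / γ * Real.sqrt μ) • absD f),
    fourier_smul_ae_eq (β / γ * Real.sqrt μ) (absD f), fourier_absD_ae_eq hf] with y h1 h2 h3
  rw [h1, h2, h3, absDSymbol]
  push_cast
  ring

theorem fourier_opB_ae_eq (γ β μ : ℝ) {f : L2} (hf : MemLp (absDSymbol f) 2 volume) :
    (𝓕 (opB γ β μ f) : L2) =ᵐ[volume]
      fun y => (1 / γ * (1 + (β - 1) / γ * Real.sqrt μ * |2 * Real.pi * y|) : ℝ) *
        (𝓕 f : L2) y := by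
  rw [opB]
  filter_upwards [fourier_smul_ae_eq (1 / γ) (f + ((β - 1) / γ * Real.sqrt μ) • absD f),
    fourier_add_ae_eq f (((β - 1) / γ * Real.sqrt μ) • absD f),
    fourier_smul_ae_eq ((β - 1) / γ * Real.sqrt μ) (absD f), fourier_absD_ae_eq hf]
    with y h0 h1 h2 h3
  rw [h0, h1, h2, h3, absDSymbol]
  push_cast
  ring

/-! ### The integral equation of a solitary wave and its decay -/

/-- The integral equation for the second component `ν` of a solitary wave. On the Fourier side and
with `ξ` eliminated, the system reads `(p + q|D|)ν = r|D|ν² + sν² + wν³`, where the bound on the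
speed is what makes `q` positive. The term `r|D|ν²` is removed by subtracting `(r/q)ν²` from `ν`, so
that only powers of `ν`, without derivatives, are left for the resolvent kernel to act upon. -/
theorem IsSolitaryWave.exists_eq_integral {γ β μ ε c : ℝ} (hγ0 : 0 < γ) (hγ1 : γ < 1) (hβ : 1 < β)
    (hμ : 0 < μ) (hc : c ^ 2 < (β - 1) * (1 - γ) / (β * γ)) {ξ ν : ℝ → ℝ}
    (h : IsSolitaryWave γ β μ ε c ξ ν) {B : ℝ} (hB : ∀ x, |ν x| ≤ B) :
    ∃ p > 0, ∃ b > 0, ∃ ρ σ τ : ℝ, ∀ x, ν x + ρ * ν x ^ 2 =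
      ∫ t, resolventKernel p b t * (σ * ν (x - t) ^ 2 + τ * ν (x - t) ^ 3) := by
  have hB0 : 0 ≤ B := (abs_nonneg _).trans (hB 0)
  have hνc := h.continuous_snd
  have hν : MemLp ν 2 volume := memLp_ofReal_iff.1 h.memH1_snd.memLp
  have hν2i : Integrable fun x => ν x ^ 2 := hν.integrable_sq
  have hν2r : MemLp (fun x => ν x ^ 2) 2 volume := by
    refine (hν.const_mul B).mono (by fun_prop) (.of_forall fun x => ?_)
    rw [norm_pow, norm_mul, Real.norm_of_nonneg hB0, sq]
    exact mul_le_mul_of_nonneg_right (hB x) (norm_nonneg _)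
  have hν3r : MemLp (fun x => ν x ^ 3) 2 volume := by
    refine (hν2r.const_mul B).mono (by fun_prop) (.of_forall fun x => ?_)
    rw [norm_pow, norm_mul, Real.norm_of_nonneg hB0, norm_pow, pow_succ' _ 2]
    exact mul_le_mul_of_nonneg_right (hB x) (by positivity)
  have hν3i : Integrable fun x => ν x ^ 3 := by
    refine (hν2i.const_mul B).mono (by fun_prop) (.of_forall fun x => ?_)
    rw [norm_pow, norm_mul, Real.norm_of_nonneg hB0, norm_pow, pow_succ' _ 2]
    exact mul_le_mul_of_nonneg_right (hB x) (by positivity)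
  have hν2 := memLp_ofReal_iff.2 hν2r
  have hν3 := memLp_ofReal_iff.2 hν3r
  have hγ1' : 0 < 1 - γ := by linarith
  have hS : 0 < Real.sqrt μ := Real.sqrt_pos.2 hμ
  have hβ0 : 0 < β := by linarith
  set S := Real.sqrt μ with hSdef
  set a := 1 / (1 - γ) with ha
  set p := 1 / γ - c ^ 2 * a with hp
  set q := S / γ * ((β - 1) / γ - c ^ 2 * a * β) with hq
  set r := c * a * ε / (2 * γ) * (β * S / γ) with hr
  set s := c * a * ε / (2 * γ) + ε / γ * a * c with hs
  set w := a * ε ^ 2 / (2 * γ ^ 2) with hw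
  -- The hypothesis on the speed, in the form that makes `q` and, since `β > 1`, also `p` positive.
  have hkey : c ^ 2 * a * β < (β - 1) / γ := by
    rw [lt_div_iff₀ (by positivity)] at hc
    rw [ha, mul_one_div, div_mul_eq_mul_div, div_lt_div_iff₀ hγ1' hγ0]
    linarith
  have hq0 : 0 < q := mul_pos (by positivity) (by linarith)
  have hp0 : 0 < p := by
    have h1 : (β - 1) / γ < β * (1 / γ) := by
      rw [mul_one_div]; exact div_lt_div_of_pos_right (by linarith) hγ0
    have h2 : β * (c ^ 2 * a) < β * (1 / γ) := by linarith
    have := lt_of_mul_lt_mul_left h2 hβ0.le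
    linarith
  refine ⟨p, hp0, 2 * Real.pi * q, by have := Real.pi_pos; positivity, -(r / q), s - r * p / q, w,
    fun x => ?_⟩
  have hf : MemLp (fun x => ((1 * ν x + -(r / q) * ν x ^ 2 : ℝ) : ℂ)) 2 volume :=
    memLp_ofReal_iff.2 ((hν.const_mul 1).add (hν2r.const_mul _))
  have hg : MemLp (fun x => (((s - r * p / q) * ν x ^ 2 + w * ν x ^ 3 : ℝ) : ℂ)) 2 volume :=
    memLp_ofReal_iff.2 ((hν2r.const_mul _).add (hν3r.const_mul _))
  have hgi : Integrable fun x => (s - r * p / q) * ν x ^ 2 + w * ν x ^ 3 :=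
    (hν2i.const_mul _).add (hν3i.const_mul _)
  have hgB : ∀ x, |(s - r * p / q) * ν x ^ 2 + w * ν x ^ 3| ≤
      |s - r * p / q| * B ^ 2 + |w| * B ^ 3 := by
    intro x
    refine (abs_add_le _ _).trans ?_
    rw [abs_mul, abs_mul, abs_pow, abs_pow]
    gcongr <;> exact hB x
  -- The first equation of the system, with `ξ` eliminated, on the Fourier side.
  have hξ : toL2 ξ = toL2 fun x => (a * c) * ν x + (a * ε / (2 * γ)) * ν x ^ 2 := by
    congr 1
    funext x
    rw [h.eq_snd x]
    ring
  have hrhs : ((-c) • opD γ β μ (toL2 ξ) + opB γ β μ (toL2 ν) : L2) =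
      toL2 fun x => (ε / γ * a * c) * ν x ^ 2 + w * ν x ^ 3 := by
    have hm : MemLp (fun x => (((ε / γ * a * c) * ν x ^ 2 + w * ν x ^ 3 : ℝ) : ℂ)) 2 volume :=
      memLp_ofReal_iff.2 ((hν2r.const_mul _).add (hν3r.const_mul _))
    refine Lp.ext ?_
    filter_upwards [h.eq_fst, toL2_ae_eq hm] with x h1 h2
    rw [h1, h2, h.eq_snd x]
    congr 1
    rw [hw, ha]
    field_simp
  have hfour : ∀ᵐ y : ℝ, ((p + 2 * Real.pi * q * |y| : ℝ) : ℂ) *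
      (𝓕 (toL2 fun x => 1 * ν x + -(r / q) * ν x ^ 2) : L2) y =
      (𝓕 (toL2 fun x => (s - r * p / q) * ν x ^ 2 + w * ν x ^ 3) : L2) y := by
    have e1 := fourier_add_ae_eq ((-c) • opD γ β μ (toL2 ξ)) (opB γ β μ (toL2 ν))
    rw [hrhs] at e1
    filter_upwards [e1, fourier_smul_ae_eq (-c) (opD γ β μ (toL2 ξ)),
      fourier_opD_ae_eq γ β μ h.memH1_fst.memLp_absDSymbol,
      fourier_opB_ae_eq γ β μ h.memH1_snd.memLp_absDSymbol,
      fourier_toL2_linear_combination_ae_eq (ε / γ * a * c) w hν2 hν3,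
      fourier_toL2_linear_combination_ae_eq (a * c) (a * ε / (2 * γ)) h.memH1_snd.memLp hν2,
      fourier_toL2_linear_combination_ae_eq 1 (-(r / q)) h.memH1_snd.memLp hν2,
      fourier_toL2_linear_combination_ae_eq (s - r * p / q) w hν2 hν3] with y e1 e2 e3 e4 e5 e6 e7 e8
    rw [e5, e2, e3, e4, hξ, e6] at e1
    rw [e7, e8]
    have hY : |2 * Real.pi * y| = 2 * Real.pi * |y| := by
      rw [abs_mul, abs_of_pos Real.two_pi_pos]
    rw [hY] at e1
    generalize (𝓕 (toL2 ν) : L2) y = n at *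
    generalize (𝓕 (toL2 fun x => ν x ^ 2) : L2) y = n2 at *
    generalize (𝓕 (toL2 fun x => ν x ^ 3) : L2) y = n3 at *
    have hq' : (q : ℂ) ≠ 0 := by exact_mod_cast hq0.ne'
    -- The equation `(p + q|D|)ν = r|D|ν² + sν² + wν³` at the frequency `y`.
    have e9 : ((p + 2 * Real.pi * q * |y| : ℝ) : ℂ) * n =
        ((r * (2 * Real.pi * |y|) + s : ℝ) : ℂ) * n2 + (w : ℂ) * n3 := by
      simp only [hp, hq, hr, hs]
      push_cast at e1 ⊢
      linear_combination -e1
    push_cast at e9 ⊢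
    field_simp
    linear_combination (q : ℂ) * e9
  have := eq_integral_resolventKernel_mul hp0 (mul_pos Real.two_pi_pos hq0) (by fun_prop) hf
    (by fun_prop) hgi hgB hg hfour x
  rw [← this, one_mul]

end BenjaminOno

open BenjaminOno Filter Topology in
theorem theorem7p1 (γ β μ ε : ℝ) (hγ0 : 0 < γ) (hγ1 : γ < 1) (hβ : 1 < β) (hμ : 0 < μ)
    (hε : 0 < ε) (c : ℝ) (hc : c ^ 2 < (β - 1) * (1 - γ) / (β * γ)) (ξ ν : ℝ → ℝ)
    (h : BenjaminOno.IsSolitaryWave γ β μ ε c ξ ν) :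
    ∃ N : ℝ, ∀ x : ℝ, x ^ 2 * |ξ x| ≤ N ∧ x ^ 2 * |ν x| ≤ N := by
  have hνc := h.continuous_snd
  have hν0 := h.memH1_snd.tendsto_cocompact hνc
  obtain ⟨B, hB⟩ := exists_abs_le_of_tendsto_cocompact hνc hν0
  have hB0 : 0 ≤ B := (abs_nonneg _).trans (hB 0)
  obtain ⟨p, hp, b, hb, ρ, σ, τ, heq⟩ := h.exists_eq_integral hγ0 hγ1 hβ hμ hc hB
  obtain ⟨C, hC⟩ := exists_sq_mul_resolventKernel_le hp hb
  -- Where `|ρ ν| ≤ 1 / 2`, the left-hand side of the integral equation controls `ν`.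
  obtain ⟨R, hR⟩ : ∃ R : ℝ, ∀ x, R ≤ |x| → |ρ * ν x| ≤ 1 / 2 := by
    have h1 : ∀ᶠ x in cocompact ℝ, |ρ * ν x| ≤ 1 / 2 := by
      have := (hν0.const_mul ρ).abs
      rw [mul_zero, abs_zero] at this
      exact this.eventually (Iic_mem_nhds (by norm_num))
    rw [← Metric.cobounded_eq_cocompact, ← comap_norm_atTop, eventually_comap] at h1
    obtain ⟨R, hR⟩ := eventually_atTop.1 h1
    exact ⟨R, fun x hx => hR _ hx x rfl⟩
  set A := |σ| + |τ| * B with hA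
  have hA0 : 0 ≤ A := by positivity
  have hki := integrable_resolventKernel hp hb
  have hk0 := fun t => resolventKernel_nonneg (p := p) hb t
  obtain ⟨N, hN⟩ := exists_sq_mul_abs_le hk0 hki hC hνc hν0 (A := 2 * A) (R := R) (by positivity) <| by
    intro x hx
    have h1 : |ν x| ≤ 2 * |ν x + ρ * ν x ^ 2| := by
      have h2 : ν x + ρ * ν x ^ 2 = ν x * (1 + ρ * ν x) := by ring
      have h3 : 1 / 2 ≤ |1 + ρ * ν x| :=
        (by linarith [(abs_le.1 (hR x hx)).1] : 1 / 2 ≤ 1 + ρ * ν x).trans (le_abs_self _)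
      rw [h2, abs_mul]
      nlinarith [mul_le_mul_of_nonneg_left h3 (abs_nonneg (ν x))]
    have h4 : |ν x + ρ * ν x ^ 2| ≤ A * ∫ t, resolventKernel p b t * ν (x - t) ^ 2 := by
      rw [heq x, ← Real.norm_eq_abs, ← integral_const_mul]
      refine norm_integral_le_of_norm_le ?_ (.of_forall fun t => ?_)
      · refine (hki.mul_bdd (c := B ^ 2) (by fun_prop) (.of_forall fun t => ?_)).const_mul A
        rw [norm_pow]
        exact pow_le_pow_left₀ (norm_nonneg _) (hB _) 2
      · rw [norm_mul, Real.norm_of_nonneg (hk0 t), mul_left_comm]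
        refine mul_le_mul_of_nonneg_left ?_ (hk0 t)
        have h5 : σ * ν (x - t) ^ 2 + τ * ν (x - t) ^ 3 =
            (σ + τ * ν (x - t)) * ν (x - t) ^ 2 := by ring
        rw [h5, norm_mul, Real.norm_of_nonneg (sq_nonneg _)]
        refine mul_le_mul_of_nonneg_right ((norm_add_le _ _).trans ?_) (sq_nonneg _)
        rw [norm_mul, hA]
        exact add_le_add le_rfl (mul_le_mul_of_nonneg_left (hB _) (abs_nonneg _))
    linarith
  set K := |1 / (1 - γ)| * (|c| + |ε / (2 * γ)| * B) with hK
  have hK0 : 0 ≤ K := by positivity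
  have hξ : ∀ x, |ξ x| ≤ K * |ν x| := by
    intro x
    have h1 : ξ x = 1 / (1 - γ) * (c + ε / (2 * γ) * ν x) * ν x := by rw [h.eq_snd x]; ring
    rw [h1, abs_mul, abs_mul]
    refine mul_le_mul_of_nonneg_right (mul_le_mul_of_nonneg_left ?_ (abs_nonneg _)) (abs_nonneg _)
    refine (abs_add_le _ _).trans (add_le_add le_rfl ?_)
    rw [abs_mul]
    exact mul_le_mul_of_nonneg_left (hB x) (abs_nonneg _)
  refine ⟨max (K * N) N, fun x => ⟨le_max_of_le_left ?_, le_max_of_le_right (hN x)⟩⟩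
  calc x ^ 2 * |ξ x| ≤ x ^ 2 * (K * |ν x|) := mul_le_mul_of_nonneg_left (hξ x) (sq_nonneg x)
    _ = K * (x ^ 2 * |ν x|) := by ring
    _ ≤ K * N := mul_le_mul_of_nonneg_left (hN x) hK0
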